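/- Fix $\epsilon>0$ and $\rho\in[0,1/2]$. For $d\in\mathbb N$, $\mu\in\mathbb R^d$ with $\|\mu\|_2>\epsilon$, and $\pi\in(0,1)$, let $(x,y)\in\mathbb R^d\times\{-1,1\}$ be distributed by $y=+1$ with probability $\pi$, $y=-1$ with probability $1-\pi$, and $x\mid y\sim\mathcal N(y\mu,I_d)$. Put $q=\ln\frac{1-\pi}{\pi}$ and $\operatorname{sign}(t)=1$ if $t\ge 0$, $\operatorname{sign}(t)=-1$ if $t<0$. Let $\Delta=\{\delta\in\mathbb R^d:\|\delta\|_2\le\epsilon\}$ and let $\mathfrak r$ be the uniform distribution on $\Delta$. For a measurable $h:\mathbb R^d\to\{-1,1\}$ let $$\mathrm{SR}(h)=\mathbb P_{(x,y)}[h(x)\ne y],\qquad \mathrm{PR}(h;\rho)=\mathbb E_{(x,y)}\Big[\mathbf 1\big[\mathbb P_{\delta\sim\mathfrak r}[h(x+\delta)\ne y]>\rho\big]\Big].$$ A spherical cap of $\Delta$ is a set $\{\delta\in\Delta: u^\top\delta\ge t\}$ with $\|u\|_2=1$ and $0\le t\le\epsilon$. Let $v_\rho$ be the Euclidean distance from the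 origin to a spherical cap $K$ of $\Delta$ with $\mathfrak r(K)=\rho$; such a cap exists and $v_\rho$ does not depend on its choice. Then $$h_p^\star(x)=\operatorname{sign}\Big(x^\top\mu\Big(1-\frac{v_\rho}{\|\mu\|_2}\Big)_+-\frac q2\Big)$$ is the optimal linear classifier: among all classifiers $x\mapsto\operatorname{sign}(x^\top w-b)$ with $w\in\mathbb R^d$, $b\in\mathbb R$, it is the unique minimizer of $\mathrm{PR}(\cdot\,;\rho)$. Moreover, with the Bayes classifier $h^\star_{\mathrm{Bayes}}(x)=\operatorname{sign}(x^\top\mu-q/2)$, $$\mathrm{PR}(h_p^\star;\rho)-\mathrm{SR}(h^\star_{\mathrm{Bayes}})=\begin{cases}O(1/\sqrt d),&\rho\in(0,1/2],\\ O(1),&\rho=0,\end{cases}$$ where the implied constants depend only on $\epsilon$ and $\rho$ (not on $d$, $\mu$ or $\pi$). -/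

import Mathlib

open MeasureTheory ProbabilityTheory
open scoped RealInnerProductSpace

noncomputable section

namespace ProbRobust

/-- The sign function with values in the label set `{-1, 1}`; the convention at `0` is `+1`. -/
def sgn (t : ℝ) : ℝ := if 0 ≤ t then 1 else -1

/-- The law of `(x, y)` where `y = 1` with probability `p`, `y = -1` with probability `1 - p`, and
`x | y` has the normal law with mean `y μ` and identity covariance. -/
def gaussianMixture {d : ℕ} (μ : EuclideanSpace ℝ (Fin d)) (p : ℝ) :
    Measure (EuclideanSpace ℝ (Fin d) × ℝ) :=
  ENNReal.ofReal p • (multivariateGaussian ((1 : ℝ) • μ) 1).map (fun x => (x, (1 : ℝ))) +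
    ENNReal.ofReal (1 - p) •
      (multivariateGaussian ((-1 : ℝ) • μ) 1).map (fun x => (x, (-1 : ℝ)))

/-- The perturbation set: the closed Euclidean ball of radius `ε` about the origin. -/
def pertSet (d : ℕ) (ε : ℝ) : Set (EuclideanSpace ℝ (Fin d)) := {δ | ‖δ‖ ≤ ε}

/-- The uniform distribution on the perturbation set (normalized Lebesgue measure). -/
def pertLaw (d : ℕ) (ε : ℝ) : Measure (EuclideanSpace ℝ (Fin d)) :=
  ProbabilityTheory.cond volume (pertSet d ε)

/-- The standard risk for the 0-1 loss, `E[1[h x ≠ y]]`. -/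
def standardRisk {d : ℕ} (D : Measure (EuclideanSpace ℝ (Fin d) × ℝ))
    (h : EuclideanSpace ℝ (Fin d) → ℝ) : ℝ :=
  ∫ z, {z : EuclideanSpace ℝ (Fin d) × ℝ | h z.1 ≠ z.2}.indicator (fun _ => (1 : ℝ)) z ∂D

/-- The probabilistically robust 0-1 risk, `E[1[P_δ[h (x + δ) ≠ y] > ρ]]`. -/
def robustRisk {d : ℕ} (D : Measure (EuclideanSpace ℝ (Fin d) × ℝ))
    (r : Measure (EuclideanSpace ℝ (Fin d))) (ρ : ℝ)
    (h : EuclideanSpace ℝ (Fin d) → ℝ) : ℝ :=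
  ∫ z, {z : EuclideanSpace ℝ (Fin d) × ℝ | r.real {δ | h (z.1 + δ) ≠ z.2} > ρ}.indicator
    (fun _ => (1 : ℝ)) z ∂D

/-- The linear classifiers `x ↦ sign (xᵀ w - b)`, the constant ones (`w = 0`) included. -/
def linearClassifiers (d : ℕ) : Set (EuclideanSpace ℝ (Fin d) → ℝ) :=
  {h | ∃ (w : EuclideanSpace ℝ (Fin d)) (b : ℝ), h = fun x => sgn (⟪x, w⟫ - b)}

/-- A spherical cap of the perturbation set: the part of the ball cut off by a hyperplane, on the
side of the hyperplane that does not contain the centre in its interior. -/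
def IsSphericalCap {d : ℕ} (ε : ℝ) (K : Set (EuclideanSpace ℝ (Fin d))) : Prop :=
  ∃ (u : EuclideanSpace ℝ (Fin d)) (t : ℝ), ‖u‖ = 1 ∧ 0 ≤ t ∧ t ≤ ε ∧
    K = {δ | δ ∈ pertSet d ε ∧ t ≤ ⟪u, δ⟫}

/-- `v` is the Euclidean distance from the origin to a spherical cap of uniform measure `ρ`. -/
def IsCapDistance (d : ℕ) (ε ρ v : ℝ) : Prop :=
  ∃ K : Set (EuclideanSpace ℝ (Fin d)),
    IsSphericalCap ε K ∧ (pertLaw d ε).real K = ρ ∧ v = Metric.infDist 0 K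

/-- `q = ln ((1 - p) / p)`. -/
def logOdds (p : ℝ) : ℝ := Real.log ((1 - p) / p)

/-- The Bayes classifier `sign (xᵀ μ - q / 2)`. -/
def bayesClassifier {d : ℕ} (μ : EuclideanSpace ℝ (Fin d)) (p : ℝ) :
    EuclideanSpace ℝ (Fin d) → ℝ :=
  fun x => sgn (⟪x, μ⟫ - logOdds p / 2)

/-- The classifier `sign (xᵀ μ (1 - v / ‖μ‖)₊ - q / 2)`. -/
def robustClassifier {d : ℕ} (μ : EuclideanSpace ℝ (Fin d)) (p v : ℝ) :
    EuclideanSpace ℝ (Fin d) → ℝ :=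
  fun x => sgn (⟪x, μ⟫ * max 0 (1 - v / ‖μ‖) - logOdds p / 2)

end ProbRobust

end

/-! ### Spherical caps of the ball and the cap distance -/

namespace ProbRobust

/-! The uniform law on the ball is rotation invariant, so for a unit normal `u` and threshold `b`
the perturbation errs with probability above `ρ` at `(x, y)` exactly when the margin `y (⟪x, u⟫ -
b)` is below the cap distance `v` (`IsCapDistance.lt_tailMass_iff`). The robust risk is therefore a
one-dimensional two-class Gaussian risk whose effective mean is `⟪μ, u⟫ - v` instead of `⟪μ, u⟫`
(`robustRisk_linear`).

That risk, `thresholdRisk p a b`, strictly decreases in `a`, and for `a > 0` its only minimizer in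
`b` is `q / (2 a)`. Cauchy-Schwarz makes `μ / ‖μ‖` the only optimal direction, and `v ≤ ε < ‖μ‖`
keeps the effective mean positive. Constant classifiers give the limits of the risk as `b → ±∞`,
which exceed the minimum.

The Bayes risk is the same minimum with `v = 0`. Since the normal distribution function is
1-Lipschitz, the excess is at most `v`. Always `v ≤ ε`; for `ρ > 0` a second moment bound
(`IsCapDistance.mul_sq_le`) gives `v ≤ ε / √(ρ d)`. -/

lemma pertSet_eq_closedBall (d : ℕ) (ε : ℝ) : pertSet d ε = Metric.closedBall 0 ε := by
  ext δ
  simp [pertSet]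

lemma measurableSet_pertSet (d : ℕ) (ε : ℝ) : MeasurableSet (pertSet d ε) := by
  rw [pertSet_eq_closedBall]
  exact Metric.isClosed_closedBall.measurableSet

lemma volume_pertSet_ne_zero (d : ℕ) {ε : ℝ} (hε : 0 < ε) : volume (pertSet d ε) ≠ 0 := by
  rw [pertSet_eq_closedBall]
  exact (Metric.measure_closedBall_pos _ _ hε).ne'

lemma volume_pertSet_ne_top (d : ℕ) (ε : ℝ) : volume (pertSet d ε) ≠ ⊤ := by
  rw [pertSet_eq_closedBall]
  exact measure_closedBall_lt_top.ne

lemma isProbabilityMeasure_pertLaw (d : ℕ) {ε : ℝ} (hε : 0 < ε) :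
    IsProbabilityMeasure (pertLaw d ε) :=
  cond_isProbabilityMeasure_of_finite (volume_pertSet_ne_zero d hε) (volume_pertSet_ne_top d ε)

/-- The mass which the perturbation law gives to the half-space `{δ | t ≤ ⟪u, δ⟫}`. -/
noncomputable def tailMass {d : ℕ} (ε : ℝ) (u : EuclideanSpace ℝ (Fin d)) (t : ℝ) : ℝ :=
  (pertLaw d ε).real {δ | t ≤ ⟪u, δ⟫}

lemma measurableSet_le_inner {d : ℕ} (u : EuclideanSpace ℝ (Fin d)) (t : ℝ) :
    MeasurableSet {δ : EuclideanSpace ℝ (Fin d) | t ≤ ⟪u, δ⟫} :=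
  measurableSet_le measurable_const (by fun_prop)

lemma pertLaw_real_cap {d : ℕ} (ε : ℝ) (u : EuclideanSpace ℝ (Fin d)) (t : ℝ) :
    (pertLaw d ε).real {δ | δ ∈ pertSet d ε ∧ t ≤ ⟪u, δ⟫} = tailMass ε u t := by
  have h : {δ | δ ∈ pertSet d ε ∧ t ≤ ⟪u, δ⟫} = pertSet d ε ∩ {δ | t ≤ ⟪u, δ⟫} := rfl
  rw [tailMass, h, measureReal_def, measureReal_def, pertLaw,
    cond_inter_self (measurableSet_pertSet d ε)]

/-- Isometries fixing the origin preserve the perturbation law. -/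
lemma pertLaw_preimage_isometry {d : ℕ} (ε : ℝ)
    (f : EuclideanSpace ℝ (Fin d) ≃ₗᵢ[ℝ] EuclideanSpace ℝ (Fin d))
    {s : Set (EuclideanSpace ℝ (Fin d))} (hs : MeasurableSet s) :
    (pertLaw d ε) (f ⁻¹' s) = (pertLaw d ε) s := by
  have hball : f ⁻¹' (pertSet d ε) = pertSet d ε := by
    ext δ
    simp [pertSet]
  rw [pertLaw, cond_apply (measurableSet_pertSet d ε), cond_apply (measurableSet_pertSet d ε)]
  congr 1
  conv_lhs => rw [← hball, ← Set.preimage_inter]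
  exact f.measurePreserving.measure_preimage
    ((measurableSet_pertSet d ε).inter hs).nullMeasurableSet

/-- The reflection in the hyperplane orthogonal to `u - w` carries `u` to `w` and preserves the law.
This is why the cap distance does not depend on the cap. -/
lemma tailMass_congr {d : ℕ} (ε : ℝ) {u w : EuclideanSpace ℝ (Fin d)} (h : ‖u‖ = ‖w‖) (t : ℝ) :
    tailMass ε u t = tailMass ε w t := by
  set f := (ℝ ∙ (u - w))ᗮ.reflection
  have hf : f u = w := Submodule.reflection_sub h
  have hpre : {δ | t ≤ ⟪u, δ⟫} = f ⁻¹' {δ | t ≤ ⟪w, δ⟫} := by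
    ext δ
    simp only [Set.mem_ofPred_eq, Set.mem_preimage]
    rw [← hf, f.inner_map_map]
  rw [tailMass, tailMass, measureReal_def, measureReal_def, hpre,
    pertLaw_preimage_isometry ε f (measurableSet_le_inner w t)]

lemma pertLaw_hyperplane {d : ℕ} (ε : ℝ) {u : EuclideanSpace ℝ (Fin d)} (hu : ‖u‖ = 1) (t : ℝ) :
    (pertLaw d ε) {δ | ⟪u, δ⟫ = t} = 0 := by
  refine cond_absolutelyContinuous ?_
  set A : AffineSubspace ℝ (EuclideanSpace ℝ (Fin d)) :=
    AffineSubspace.mk' (t • u) (LinearMap.ker (innerₛₗ ℝ u)) with hA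
  have hmem : ∀ δ, δ ∈ A ↔ ⟪u, δ⟫ = t := by
    intro δ
    rw [hA, AffineSubspace.mem_mk', LinearMap.mem_ker]
    simp [inner_sub_right, inner_smul_right, hu, sub_eq_zero]
  have hset : {δ | ⟪u, δ⟫ = t} = (A : Set (EuclideanSpace ℝ (Fin d))) := by
    ext δ
    exact (hmem δ).symm
  rw [hset]
  refine Measure.addHaar_affineSubspace _ _ fun htop => ?_
  -- The point `(t + 1) • u` has inner product `t + 1` with `u`, so the hyperplane is a proper
  -- subspace.
  have h1 : (t + 1) • u ∈ A := htop ▸ AffineSubspace.mem_top _ _ _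
  have h2 := (hmem _).1 h1
  simp [inner_smul_right, hu] at h2

lemma pertLaw_real_lt_inner {d : ℕ} (ε : ℝ) {u : EuclideanSpace ℝ (Fin d)} (hu : ‖u‖ = 1)
    (t : ℝ) : (pertLaw d ε).real {δ | t < ⟪u, δ⟫} = tailMass ε u t := by
  refine measureReal_congr ?_
  have h : ∀ᵐ δ ∂(pertLaw d ε), ⟪u, δ⟫ ≠ t := by
    rw [ae_iff]
    simpa using pertLaw_hyperplane ε hu t
  filter_upwards [h] with δ hδ
  exact propext ⟨fun h => le_of_lt h, fun h => lt_of_le_of_ne h hδ.symm⟩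

lemma antitone_tailMass {d : ℕ} {ε : ℝ} (hε : 0 < ε) (u : EuclideanSpace ℝ (Fin d)) :
    Antitone (tailMass ε u) := by
  intro s t hst
  have := isProbabilityMeasure_pertLaw d hε
  exact measureReal_mono fun δ (hδ : t ≤ ⟪u, δ⟫) => hst.trans hδ

lemma strictAntiOn_tailMass {d : ℕ} {ε : ℝ} (hε : 0 < ε) {u : EuclideanSpace ℝ (Fin d)}
    (hu : ‖u‖ = 1) : StrictAntiOn (tailMass ε u) (Set.Icc (-ε) ε) := by
  intro s hs t ht hst
  have := isProbabilityMeasure_pertLaw d hε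
  set S : Set (EuclideanSpace ℝ (Fin d)) := {δ | s < ⟪u, δ⟫} ∩ {δ | ⟪u, δ⟫ < t}
  have hSo : IsOpen S :=
    (isOpen_lt continuous_const (by fun_prop)).inter (isOpen_lt (by fun_prop) continuous_const)
  have hSpos : 0 < (pertLaw d ε) S := by
    rw [pertLaw, cond_apply (measurableSet_pertSet d ε)]
    refine ENNReal.mul_pos (ENNReal.inv_ne_zero.2 (volume_pertSet_ne_top d ε)) ?_
    have hne : (Metric.ball (0 : EuclideanSpace ℝ (Fin d)) ε ∩ S).Nonempty := by
      -- The open slab between the two hyperplanes meets the open ball at the midpoint along `u`, so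
      -- it has positive mass.
      refine ⟨((s + t) / 2) • u, ?_, ?_, ?_⟩
      · rw [mem_ball_zero_iff, norm_smul, hu, mul_one, Real.norm_eq_abs, abs_lt]
        constructor <;> linarith [hs.1, ht.2]
      · simp only [Set.mem_ofPred_eq, inner_smul_right, real_inner_self_eq_norm_sq, hu]
        linarith
      · simp only [Set.mem_ofPred_eq, inner_smul_right, real_inner_self_eq_norm_sq, hu]
        linarith
    refine ((Metric.isOpen_ball.inter hSo).measure_pos volume hne).ne' ∘ fun h => ?_
    refine measure_mono_null (Set.inter_subset_inter_left _ ?_) h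
    rw [pertSet_eq_closedBall]
    exact Metric.ball_subset_closedBall
  have hdisj : Disjoint {δ | t ≤ ⟪u, δ⟫} S := by
    rw [Set.disjoint_left]
    intro δ (h1 : t ≤ ⟪u, δ⟫) h2
    exact absurd h2.2 (not_lt.2 h1)
  have hle : (pertLaw d ε).real ({δ | t ≤ ⟪u, δ⟫} ∪ S) ≤ tailMass ε u s := by
    refine measureReal_mono ?_
    rintro δ (h | h)
    · exact hst.le.trans h
    · exact le_of_lt (Set.mem_ofPred.1 h.1)
  rw [measureReal_union hdisj hSo.measurableSet] at hle
  have hpos : 0 < (pertLaw d ε).real S :=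
    ENNReal.toReal_pos hSpos.ne' (measure_ne_top _ _)
  change tailMass ε u t + _ ≤ _ at hle
  linarith

/-- Dominated convergence: for fixed `δ` the indicator is locally constant in `t` away from `t = ⟪u,
δ⟫`, and hyperplanes are null. -/
lemma continuous_tailMass {d : ℕ} {ε : ℝ} (hε : 0 < ε) {u : EuclideanSpace ℝ (Fin d)}
    (hu : ‖u‖ = 1) : Continuous (tailMass ε u) := by
  have := isProbabilityMeasure_pertLaw d hε
  have heq : tailMass ε u = fun t => ∫ δ, (Set.Iic ⟪u, δ⟫).indicator (fun _ => (1 : ℝ)) t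
      ∂(pertLaw d ε) := by
    funext t
    rw [tailMass, ← integral_indicator_one (measurableSet_le_inner u t)]
    rfl
  rw [heq, continuous_iff_continuousAt]
  intro t
  refine continuousAt_of_dominated (bound := fun _ => 1) ?_ ?_ (integrable_const _) ?_
  · refine Filter.Eventually.of_forall fun s => ?_
    exact ((measurable_const (a := (1 : ℝ))).indicator
      (measurableSet_le_inner u s)).aestronglyMeasurable
  · refine Filter.Eventually.of_forall fun s => Filter.Eventually.of_forall fun δ => ?_
    refine (norm_indicator_le_norm_self _ _).trans ?_
    simp
  · have h : ∀ᵐ δ ∂(pertLaw d ε), ⟪u, δ⟫ ≠ t := by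
      rw [ae_iff]
      simpa using pertLaw_hyperplane ε hu t
    filter_upwards [h] with δ hδ
    rcases lt_or_gt_of_ne hδ with h | h
    · refine (continuousAt_const (y := (0 : ℝ))).congr ?_
      filter_upwards [Ioi_mem_nhds h] with s hs
      rw [Set.indicator_of_notMem (by simpa using hs)]
    · refine (continuousAt_const (y := (1 : ℝ))).congr ?_
      filter_upwards [Iio_mem_nhds h] with s hs
      rw [Set.indicator_of_mem (by simpa using le_of_lt hs)]

lemma tailMass_zero {d : ℕ} {ε : ℝ} (hε : 0 < ε) {u : EuclideanSpace ℝ (Fin d)}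
    (hu : ‖u‖ = 1) : tailMass ε u 0 = 1 / 2 := by
  have := isProbabilityMeasure_pertLaw d hε
  have hcompl : {δ : EuclideanSpace ℝ (Fin d) | 0 < ⟪-u, δ⟫} = {δ | 0 ≤ ⟪u, δ⟫}ᶜ := by
    ext δ
    simp
  have h1 : tailMass ε (-u) 0 = 1 - tailMass ε u 0 := by
    rw [← pertLaw_real_lt_inner ε (by simpa using hu), hcompl,
      probReal_compl_eq_one_sub (measurableSet_le_inner u 0)]
    rfl
  rw [tailMass_congr ε (norm_neg u)] at h1
  linarith

lemma tailMass_radius {d : ℕ} (ε : ℝ) {u : EuclideanSpace ℝ (Fin d)} (hu : ‖u‖ = 1) :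
    tailMass ε u ε = 0 := by
  rw [← pertLaw_real_lt_inner ε hu, measureReal_def, pertLaw,
    cond_apply (measurableSet_pertSet d ε)]
  have : pertSet d ε ∩ {δ | ε < ⟪u, δ⟫} = ∅ := by
    rw [Set.eq_empty_iff_forall_notMem]
    rintro δ ⟨h1, h2⟩
    have h3 := real_inner_le_norm u δ
    rw [hu, one_mul] at h3
    exact absurd (lt_of_lt_of_le h2 (h3.trans h1)) (lt_irrefl _)
  simp [this]

lemma infDist_cap {d : ℕ} {ε t : ℝ} {u : EuclideanSpace ℝ (Fin d)} (hu : ‖u‖ = 1) (h0 : 0 ≤ t)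
    (hε : t ≤ ε) : Metric.infDist 0 {δ | δ ∈ pertSet d ε ∧ t ≤ ⟪u, δ⟫} = t := by
  have hnorm : ‖t • u‖ = t := by rw [norm_smul, hu, mul_one, Real.norm_of_nonneg h0]
  have hmem : t • u ∈ {δ | δ ∈ pertSet d ε ∧ t ≤ ⟪u, δ⟫} := by
    refine ⟨hnorm.trans_le hε, ?_⟩
    simp [inner_smul_right, hu]
  refine le_antisymm ?_ ?_
  · refine (Metric.infDist_le_dist_of_mem hmem).trans ?_
    rw [dist_zero_left, hnorm]
  · refine (Metric.le_infDist ⟨_, hmem⟩).2 fun δ hδ => ?_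
    have h3 := real_inner_le_norm u δ
    rw [hu, one_mul] at h3
    rw [dist_zero_left]
    exact hδ.2.trans h3

lemma isCapDistance_of_tailMass {d : ℕ} {ε v : ℝ} {u : EuclideanSpace ℝ (Fin d)} (hu : ‖u‖ = 1)
    (h0 : 0 ≤ v) (hε : v ≤ ε) : IsCapDistance d ε (tailMass ε u v) v :=
  ⟨_, ⟨u, v, hu, h0, hε, rfl⟩, pertLaw_real_cap ε u v, (infDist_cap hu h0 hε).symm⟩

lemma IsCapDistance.spec {d : ℕ} {ε ρ v : ℝ} (h : IsCapDistance d ε ρ v) :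
    0 ≤ v ∧ v ≤ ε ∧ ∀ u : EuclideanSpace ℝ (Fin d), ‖u‖ = 1 → tailMass ε u v = ρ := by
  obtain ⟨K, ⟨w, t, hw, h0, hε, rfl⟩, hK, hv⟩ := h
  rw [infDist_cap hw h0 hε] at hv
  subst hv
  refine ⟨h0, hε, fun u hu => ?_⟩
  rw [tailMass_congr ε (hu.trans hw.symm), ← hK, pertLaw_real_cap]

/-- The tail mass falls continuously and strictly from `1 / 2` at `0` to `0` at `ε`. -/
lemma existsUnique_isCapDistance {d : ℕ} {ε ρ : ℝ} (hε : 0 < ε) (hρ0 : 0 ≤ ρ) (hρ1 : ρ ≤ 1 / 2)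
    {u : EuclideanSpace ℝ (Fin d)} (hu : ‖u‖ = 1) : ∃! v : ℝ, IsCapDistance d ε ρ v := by
  obtain ⟨v, hv, rfl⟩ : ρ ∈ tailMass ε u '' Set.Icc 0 ε := by
    refine intermediate_value_Icc' hε.le (continuous_tailMass hε hu).continuousOn ?_
    rw [tailMass_zero hε hu, tailMass_radius ε hu]
    exact ⟨hρ0, hρ1⟩
  refine ⟨v, isCapDistance_of_tailMass hu hv.1 hv.2, fun w hw => ?_⟩
  obtain ⟨hw0, hw1, hw2⟩ := hw.spec
  exact (strictAntiOn_tailMass hε hu).injOn ⟨by linarith, hw1⟩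
    ⟨by linarith [hv.1], hv.2⟩ (hw2 u hu)

lemma IsCapDistance.lt_tailMass_iff {d : ℕ} {ε ρ v : ℝ} (hε : 0 < ε) (h : IsCapDistance d ε ρ v)
    {u : EuclideanSpace ℝ (Fin d)} (hu : ‖u‖ = 1) (s : ℝ) : ρ < tailMass ε u s ↔ s < v := by
  obtain ⟨h0, h1, h2⟩ := h.spec
  rw [← h2 u hu]
  refine ⟨fun hs => lt_of_not_ge fun hvs => absurd hs (antitone_tailMass hε u hvs).not_gt,
    fun hs => ?_⟩
  -- Strict monotonicity is available only on `[-ε, ε]`, so `s` is first raised to at least `-ε`.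
  have hlt : max s (-ε) < v := max_lt hs (by linarith)
  refine (strictAntiOn_tailMass hε hu ⟨le_max_right _ _, by linarith⟩ ⟨by linarith, h1⟩
    hlt).trans_le ?_
  exact antitone_tailMass hε u (le_max_left _ _)

/-- The second moment bound for the cap distance. -/
lemma IsCapDistance.mul_sq_le {d : ℕ} {ε ρ v : ℝ} (hε : 0 < ε) (h : IsCapDistance d ε ρ v) :
    d * ρ * v ^ 2 ≤ ε ^ 2 := by
  have := isProbabilityMeasure_pertLaw d hε
  obtain ⟨h0, -, h2⟩ := h.spec
  let e : Fin d → EuclideanSpace ℝ (Fin d) := fun i => EuclideanSpace.basisFun (Fin d) ℝ i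
  let F : EuclideanSpace ℝ (Fin d) → ℝ := fun δ =>
    -- A Chebyshev argument over all coordinates at once: each term has mean `ρ * v ^ 2`, while the
    -- sum is at most `‖δ‖ ^ 2 ≤ ε ^ 2`.
    ∑ i, {δ | v ≤ ⟪e i, δ⟫}.indicator (fun _ => v ^ 2) δ
  have hint : ∀ i, Integrable ({δ | v ≤ ⟪e i, δ⟫}.indicator (fun _ => v ^ 2)) (pertLaw d ε) :=
    fun i => (integrable_const _).indicator (measurableSet_le_inner _ _)
  have hF : ∫ δ, F δ ∂(pertLaw d ε) = d * ρ * v ^ 2 := by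
    rw [integral_finsetSum _ fun i _ => hint i]
    have : ∀ i, ∫ δ, {δ | v ≤ ⟪e i, δ⟫}.indicator (fun _ => v ^ 2) δ ∂(pertLaw d ε)
        = ρ * v ^ 2 := by
      intro i
      rw [integral_indicator_const _ (measurableSet_le_inner _ _), smul_eq_mul]
      congr 1
      exact h2 (e i) ((EuclideanSpace.basisFun (Fin d) ℝ).norm_eq_one i)
    simp [this, mul_assoc]
  have hbound : ∀ᵐ δ ∂(pertLaw d ε), F δ ≤ ε ^ 2 := by
    filter_upwards [ae_cond_mem (measurableSet_pertSet d ε)] with δ hδ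
    have hsum : F δ ≤ ∑ i, ⟪e i, δ⟫ ^ 2 := by
      refine Finset.sum_le_sum fun i _ => Set.indicator_apply_le' (fun hi => ?_) fun _ =>
        sq_nonneg _
      exact pow_le_pow_left₀ h0 hi 2
    have hnorm : ∑ i, ⟪e i, δ⟫ ^ 2 = ‖δ‖ ^ 2 :=
      (EuclideanSpace.basisFun (Fin d) ℝ).sum_sq_inner_right δ
    rw [hnorm] at hsum
    exact hsum.trans (pow_le_pow_left₀ (norm_nonneg _) hδ 2)
  rw [← hF]
  calc ∫ δ, F δ ∂(pertLaw d ε) ≤ ∫ _, ε ^ 2 ∂(pertLaw d ε) :=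
        integral_mono_ae (integrable_finsetSum _ fun i _ => hint i) (integrable_const _) hbound
    _ = ε ^ 2 := by simp

end ProbRobust

/-! ### The one-dimensional Gaussian threshold problem -/

namespace ProbRobust

/-- The distribution function of the standard normal law. -/
noncomputable def stdNormalCDF (x : ℝ) : ℝ := (gaussianReal 0 1).real (Set.Iic x)

lemma stdNormalCDF_eq_cdf : stdNormalCDF = fun x => cdf (gaussianReal 0 1) x := by
  funext x
  rw [cdf_eq_real, stdNormalCDF]

lemma stdNormalCDF_eq_integral (x : ℝ) :
    stdNormalCDF x = ∫ y in Set.Iic x, gaussianPDFReal 0 1 y := by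
  rw [stdNormalCDF, measureReal_def, gaussianReal_apply_eq_integral 0 one_ne_zero,
    ENNReal.toReal_ofReal]
  exact integral_nonneg fun y => gaussianPDFReal_nonneg 0 1 y

lemma stdNormalPDF_eq (x : ℝ) :
    gaussianPDFReal 0 1 x = (√(2 * Real.pi))⁻¹ * Real.exp (-x ^ 2 / 2) := by
  simp [gaussianPDFReal]

lemma continuous_stdNormalPDF : Continuous (gaussianPDFReal 0 1) := by
  have : gaussianPDFReal 0 1 = fun x => (√(2 * Real.pi))⁻¹ * Real.exp (-x ^ 2 / 2) :=
    funext stdNormalPDF_eq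
  rw [this]
  fun_prop

lemma stdNormalPDF_le_one (x : ℝ) : gaussianPDFReal 0 1 x ≤ 1 := by
  rw [stdNormalPDF_eq]
  have h1 : (√(2 * Real.pi))⁻¹ ≤ 1 := by
    refine inv_le_one_of_one_le₀ ?_
    rw [Real.one_le_sqrt]
    linarith [Real.pi_gt_three]
  have h2 : Real.exp (-x ^ 2 / 2) ≤ 1 := by
    rw [Real.exp_le_one_iff]
    linarith [sq_nonneg x]
  exact mul_le_one₀ h1 (Real.exp_pos _).le h2

lemma hasDerivAt_stdNormalCDF (x : ℝ) : HasDerivAt stdNormalCDF (gaussianPDFReal 0 1 x) x := by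
  have hint := integrable_gaussianPDFReal 0 1
  have heq : stdNormalCDF = fun x => stdNormalCDF 0 + ∫ y in (0 : ℝ)..x, gaussianPDFReal 0 1 y := by
    funext x
    rw [intervalIntegral.integral_Iic_sub_Iic (μ := volume) hint.integrableOn
      hint.integrableOn |>.symm, stdNormalCDF_eq_integral, stdNormalCDF_eq_integral]
    ring
  rw [heq]
  exact (intervalIntegral.integral_hasDerivAt_right
    (continuous_stdNormalPDF.intervalIntegrable _ _)
    (continuous_stdNormalPDF.stronglyMeasurableAtFilter _ _)
    continuous_stdNormalPDF.continuousAt).const_add _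

lemma strictMono_stdNormalCDF : StrictMono stdNormalCDF :=
  strictMono_of_deriv_pos fun x => by
    rw [(hasDerivAt_stdNormalCDF x).deriv]
    exact gaussianPDFReal_pos 0 1 x one_ne_zero

lemma stdNormalCDF_sub_le {x y : ℝ} (h : x ≤ y) :
    stdNormalCDF y - stdNormalCDF x ≤ y - x := by
  have := image_sub_le_mul_sub_of_deriv_le (f := stdNormalCDF) (C := 1)
    (fun x => (hasDerivAt_stdNormalCDF x).differentiableAt)
    (fun x => by
      rw [(hasDerivAt_stdNormalCDF x).deriv]
      exact stdNormalPDF_le_one x) (x := x) (y := y) h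
  linarith

lemma tendsto_stdNormalCDF_atBot : Filter.Tendsto stdNormalCDF Filter.atBot (nhds 0) := by
  rw [stdNormalCDF_eq_cdf]
  exact tendsto_cdf_atBot _

lemma tendsto_stdNormalCDF_atTop : Filter.Tendsto stdNormalCDF Filter.atTop (nhds 1) := by
  rw [stdNormalCDF_eq_cdf]
  exact tendsto_cdf_atTop _

/-- The error of the threshold `b` in the one-dimensional two-class problem with normal classes of
means `a` and `-a`. -/
noncomputable def thresholdRisk (p a b : ℝ) : ℝ :=
  p * stdNormalCDF (b - a) + (1 - p) * stdNormalCDF (-b - a)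

lemma thresholdRisk_lt_of_lt {p a a' : ℝ} (hp0 : 0 < p) (hp1 : p < 1) (h : a < a') (b : ℝ) :
    thresholdRisk p a' b < thresholdRisk p a b := by
  have h1 := strictMono_stdNormalCDF (show b - a' < b - a by linarith)
  have h2 := strictMono_stdNormalCDF (show -b - a' < -b - a by linarith)
  have h3 := mul_lt_mul_of_pos_left h1 hp0
  have h4 := mul_lt_mul_of_pos_left h2 (sub_pos.2 hp1)
  unfold thresholdRisk
  linarith

lemma thresholdRisk_sub_le {p a a' : ℝ} (hp0 : 0 < p) (hp1 : p < 1) (h : a ≤ a') (b : ℝ) :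
    thresholdRisk p a b - thresholdRisk p a' b ≤ a' - a := by
  have h1 := stdNormalCDF_sub_le (show b - a' ≤ b - a by linarith)
  have h2 := stdNormalCDF_sub_le (show -b - a' ≤ -b - a by linarith)
  have h3 := mul_le_mul_of_nonneg_left h1 hp0.le
  have h4 := mul_le_mul_of_nonneg_left h2 (sub_pos.2 hp1).le
  unfold thresholdRisk
  linarith

lemma hasDerivAt_thresholdRisk (p a b : ℝ) :
    HasDerivAt (thresholdRisk p a)
      (p * gaussianPDFReal 0 1 (b - a) - (1 - p) * gaussianPDFReal 0 1 (b + a)) b := by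
  have h1 : HasDerivAt (fun b => stdNormalCDF (b - a)) (gaussianPDFReal 0 1 (b - a) * 1) b :=
    HasDerivAt.comp (h₂ := stdNormalCDF) b (hasDerivAt_stdNormalCDF (b - a)) ((hasDerivAt_id b).sub_const a)
  have h2 : HasDerivAt (fun b => stdNormalCDF (-b - a)) (gaussianPDFReal 0 1 (-b - a) * (-1)) b :=
    HasDerivAt.comp (h₂ := stdNormalCDF) b (hasDerivAt_stdNormalCDF (-b - a)) ((hasDerivAt_id b).neg.sub_const a)
  have heven : gaussianPDFReal 0 1 (-b - a) = gaussianPDFReal 0 1 (b + a) := by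
    rw [stdNormalPDF_eq, stdNormalPDF_eq]
    congr 3
    ring
  refine ((h1.const_mul p).add (h2.const_mul (1 - p))).congr_deriv ?_
  rw [heven]
  ring

/-- The ratio of the two class densities at `b` is `exp (2 a b)`. Factoring it out shows that the
derivative has the sign of `2 a b - q`. -/
lemma thresholdRisk_deriv_eq {p : ℝ} (hp0 : 0 < p) (hp1 : p < 1) (a b : ℝ) :
    p * gaussianPDFReal 0 1 (b - a) - (1 - p) * gaussianPDFReal 0 1 (b + a) =
      p * gaussianPDFReal 0 1 (b + a) * (Real.exp (2 * a * b) - Real.exp (logOdds p)) := by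
  have h1 : gaussianPDFReal 0 1 (b - a) = gaussianPDFReal 0 1 (b + a) * Real.exp (2 * a * b) := by
    rw [stdNormalPDF_eq, stdNormalPDF_eq, mul_assoc, ← Real.exp_add]
    congr 2
    ring
  have h2 : Real.exp (logOdds p) = (1 - p) / p := by
    rw [logOdds, Real.exp_log (div_pos (sub_pos.2 hp1) hp0)]
  rw [h1, h2]
  field_simp

lemma continuous_thresholdRisk (p a : ℝ) : Continuous (thresholdRisk p a) :=
  continuous_iff_continuousAt.2 fun b => (hasDerivAt_thresholdRisk p a b).continuousAt

lemma strictMonoOn_thresholdRisk {p a : ℝ} (hp0 : 0 < p) (hp1 : p < 1) (ha : 0 < a) :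
    StrictMonoOn (thresholdRisk p a) (Set.Ici (logOdds p / (2 * a))) := by
  refine strictMonoOn_of_deriv_pos (convex_Ici _) (continuous_thresholdRisk p a).continuousOn ?_
  intro b hb
  rw [interior_Ici, Set.mem_Ioi, div_lt_iff₀ (by positivity)] at hb
  rw [(hasDerivAt_thresholdRisk p a b).deriv, thresholdRisk_deriv_eq hp0 hp1]
  refine mul_pos (mul_pos hp0 (gaussianPDFReal_pos 0 1 _ one_ne_zero)) ?_
  rw [sub_pos, Real.exp_lt_exp]
  linarith

lemma strictAntiOn_thresholdRisk {p a : ℝ} (hp0 : 0 < p) (hp1 : p < 1) (ha : 0 < a) :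
    StrictAntiOn (thresholdRisk p a) (Set.Iic (logOdds p / (2 * a))) := by
  refine strictAntiOn_of_deriv_neg (convex_Iic _) (continuous_thresholdRisk p a).continuousOn ?_
  intro b hb
  rw [interior_Iic, Set.mem_Iio, lt_div_iff₀ (by positivity)] at hb
  rw [(hasDerivAt_thresholdRisk p a b).deriv, thresholdRisk_deriv_eq hp0 hp1]
  refine mul_neg_of_pos_of_neg (mul_pos hp0 (gaussianPDFReal_pos 0 1 _ one_ne_zero)) ?_
  rw [sub_neg, Real.exp_lt_exp]
  linarith

lemma thresholdRisk_lt_of_ne {p a b : ℝ} (hp0 : 0 < p) (hp1 : p < 1) (ha : 0 < a)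
    (hb : b ≠ logOdds p / (2 * a)) :
    thresholdRisk p a (logOdds p / (2 * a)) < thresholdRisk p a b := by
  rcases lt_or_gt_of_ne hb with h | h
  · exact strictAntiOn_thresholdRisk hp0 hp1 ha h.le Set.self_mem_Iic h
  · exact strictMonoOn_thresholdRisk hp0 hp1 ha Set.self_mem_Ici h.le h

lemma thresholdRisk_min_le {p a : ℝ} (hp0 : 0 < p) (hp1 : p < 1) (ha : 0 < a) (b : ℝ) :
    thresholdRisk p a (logOdds p / (2 * a)) ≤ thresholdRisk p a b := by
  by_cases hb : b = logOdds p / (2 * a)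
  · rw [hb]
  · exact (thresholdRisk_lt_of_ne hp0 hp1 ha hb).le

open Filter in
lemma tendsto_thresholdRisk_atBot (p a : ℝ) :
    Tendsto (thresholdRisk p a) atBot (nhds (1 - p)) := by
  have h1 : Tendsto (fun b : ℝ => b - a) atBot atBot := tendsto_atBot_add_const_right _ _ tendsto_id
  have h2 : Tendsto (fun b : ℝ => -b - a) atBot atTop :=
    tendsto_atTop_add_const_right _ _ tendsto_neg_atBot_atTop
  have := ((tendsto_stdNormalCDF_atBot.comp h1).const_mul p).add
    ((tendsto_stdNormalCDF_atTop.comp h2).const_mul (1 - p))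
  simp only [mul_zero, mul_one, zero_add] at this
  exact this

open Filter in
lemma tendsto_thresholdRisk_atTop (p a : ℝ) :
    Tendsto (thresholdRisk p a) atTop (nhds p) := by
  have h1 : Tendsto (fun b : ℝ => b - a) atTop atTop := tendsto_atTop_add_const_right _ _ tendsto_id
  have h2 : Tendsto (fun b : ℝ => -b - a) atTop atBot :=
    tendsto_atBot_add_const_right _ _ tendsto_neg_atTop_atBot
  have := ((tendsto_stdNormalCDF_atTop.comp h1).const_mul p).add
    ((tendsto_stdNormalCDF_atBot.comp h2).const_mul (1 - p))
  simp only [mul_zero, mul_one, add_zero] at this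
  exact this

lemma thresholdRisk_min_lt_one_sub {p a : ℝ} (hp0 : 0 < p) (hp1 : p < 1) (ha : 0 < a) :
    thresholdRisk p a (logOdds p / (2 * a)) < 1 - p := by
  set c := logOdds p / (2 * a)
  -- Passing to the limit `b → -∞` loses strictness, so the strict step is taken beforehand, from
  -- `c` to `c - 1`.
  refine (thresholdRisk_lt_of_ne hp0 hp1 ha (sub_one_lt c).ne).trans_le ?_
  refine ge_of_tendsto (tendsto_thresholdRisk_atBot p a) ?_
  filter_upwards [Filter.eventually_le_atBot (c - 1)] with b hb
  exact (strictAntiOn_thresholdRisk hp0 hp1 ha).antitoneOn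
    (Set.mem_Iic.2 (hb.trans (sub_one_lt c).le)) (Set.mem_Iic.2 (sub_one_lt c).le) hb

lemma thresholdRisk_min_lt {p a : ℝ} (hp0 : 0 < p) (hp1 : p < 1) (ha : 0 < a) :
    thresholdRisk p a (logOdds p / (2 * a)) < p := by
  set c := logOdds p / (2 * a)
  refine (thresholdRisk_lt_of_ne hp0 hp1 ha (lt_add_one c).ne').trans_le ?_
  refine ge_of_tendsto (tendsto_thresholdRisk_atTop p a) ?_
  filter_upwards [Filter.eventually_ge_atTop (c + 1)] with b hb
  exact (strictMonoOn_thresholdRisk hp0 hp1 ha).monotoneOn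
    (Set.mem_Ici.2 (lt_add_one c).le) (Set.mem_Ici.2 ((lt_add_one c).le.trans hb)) hb

end ProbRobust

/-! ### Risks of linear classifiers as one-dimensional risks -/

namespace ProbRobust

/-- A standard Gaussian vector paired with `u` is a real Gaussian of mean `0` and variance `‖u‖ ^ 2
= 1`. -/
lemma multivariateGaussian_real_inner_sub_mem {d : ℕ} (ν : EuclideanSpace ℝ (Fin d))
    {u : EuclideanSpace ℝ (Fin d)} (hu : ‖u‖ = 1) {s : Set ℝ} (hs : MeasurableSet s) :
    (multivariateGaussian ν 1).real {x | ⟪x, u⟫ - ⟪ν, u⟫ ∈ s} = (gaussianReal 0 1).real s := by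
  have hmap : (stdGaussian (EuclideanSpace ℝ (Fin d))).map (innerSL ℝ u) = gaussianReal 0 1 := by
    rw [IsGaussian.map_eq_gaussianReal, integral_strongDual_stdGaussian, variance_dual_stdGaussian,
      innerSL_apply_norm, hu]
    simp
  have hmeas : MeasurableSet {x : EuclideanSpace ℝ (Fin d) | ⟪x, u⟫ - ⟪ν, u⟫ ∈ s} := by
    have : Measurable fun x : EuclideanSpace ℝ (Fin d) => ⟪x, u⟫ - ⟪ν, u⟫ := by fun_prop
    exact this hs
  have hG : multivariateGaussian ν (1 : Matrix (Fin d) (Fin d) ℝ) =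
      (stdGaussian (EuclideanSpace ℝ (Fin d))).map (fun x => ν + x) := by
    simp [multivariateGaussian]
  rw [hG, map_measureReal_apply (by fun_prop) hmeas, ← hmap,
    map_measureReal_apply (by fun_prop) hs]
  congr 1
  ext x
  simp [real_inner_comm u, inner_add_right]

lemma multivariateGaussian_real_inner_le {d : ℕ} (ν : EuclideanSpace ℝ (Fin d))
    {u : EuclideanSpace ℝ (Fin d)} (hu : ‖u‖ = 1) (t : ℝ) :
    (multivariateGaussian ν 1).real {x | ⟪x, u⟫ ≤ t} = stdNormalCDF (t - ⟪ν, u⟫) := by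
  rw [stdNormalCDF, ← multivariateGaussian_real_inner_sub_mem ν hu measurableSet_Iic]
  simp

lemma multivariateGaussian_real_inner_lt {d : ℕ} (ν : EuclideanSpace ℝ (Fin d))
    {u : EuclideanSpace ℝ (Fin d)} (hu : ‖u‖ = 1) (t : ℝ) :
    (multivariateGaussian ν 1).real {x | ⟪x, u⟫ < t} = stdNormalCDF (t - ⟪ν, u⟫) := by
  have := nullSingletonClass_gaussianReal (μ := 0) (v := 1) one_ne_zero
  rw [stdNormalCDF, ← measureReal_congr Iio_ae_eq_Iic,
    ← multivariateGaussian_real_inner_sub_mem ν hu measurableSet_Iio]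
  simp

/-- Only the slices of `S` at the labels `1` and `-1` matter. Since `x ↦ (x, c)` is a measurable
embedding, `S` itself need not be measurable. -/
lemma integral_indicator_gaussianMixture {d : ℕ} (μ : EuclideanSpace ℝ (Fin d)) {p : ℝ}
    (hp0 : 0 < p) (hp1 : p < 1) {S : Set (EuclideanSpace ℝ (Fin d) × ℝ)}
    {A B : Set (EuclideanSpace ℝ (Fin d))} (hA : MeasurableSet A) (hB : MeasurableSet B)
    (hSA : ∀ x, (x, 1) ∈ S ↔ x ∈ A) (hSB : ∀ x, (x, -1) ∈ S ↔ x ∈ B) :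
    ∫ z, S.indicator (fun _ => (1 : ℝ)) z ∂(gaussianMixture μ p) =
      p * (multivariateGaussian μ 1).real A + (1 - p) * (multivariateGaussian (-μ) 1).real B := by
  have hf : ∀ (ν : EuclideanSpace ℝ (Fin d)) (c : ℝ) (T : Set (EuclideanSpace ℝ (Fin d))),
      MeasurableSet T → (∀ x, (x, c) ∈ S ↔ x ∈ T) →
      Integrable (S.indicator fun _ => (1 : ℝ))
        ((multivariateGaussian ν 1).map fun x => (x, c)) ∧
      ∫ z, S.indicator (fun _ => (1 : ℝ)) z ∂((multivariateGaussian ν 1).map fun x => (x, c)) =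
        (multivariateGaussian ν 1).real T := by
    intro ν c T hT hST
    have he : MeasurableEmbedding fun x : EuclideanSpace ℝ (Fin d) => (x, c) :=
      measurableEmbedding_prod_mk_right c
    have hcomp : (fun x => S.indicator (fun _ => (1 : ℝ)) (x, c)) = T.indicator 1 := by
      classical
      funext x
      simp only [Set.indicator_apply, hST, Pi.one_apply]
    refine ⟨(he.integrable_map_iff).2 ?_, ?_⟩
    · change Integrable (fun x => S.indicator (fun _ => (1 : ℝ)) (x, c)) _
      rw [hcomp]
      exact (integrable_const (1 : ℝ)).indicator hT
    · rw [he.integral_map, hcomp, integral_indicator_one hT]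
  obtain ⟨i1, e1⟩ := hf ((1 : ℝ) • μ) 1 A hA hSA
  obtain ⟨i2, e2⟩ := hf ((-1 : ℝ) • μ) (-1) B hB hSB
  rw [gaussianMixture, integral_add_measure (i1.smul_measure ENNReal.ofReal_ne_top)
    (i2.smul_measure ENNReal.ofReal_ne_top), integral_smul_measure, integral_smul_measure, e1, e2,
    ENNReal.toReal_ofReal hp0.le, ENNReal.toReal_ofReal (sub_pos.2 hp1).le]
  simp

lemma sgn_ne_one_iff (t : ℝ) : sgn t ≠ 1 ↔ t < 0 := by
  unfold sgn
  split_ifs with h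
  · simpa using h
  · norm_num
    exact not_le.1 h

lemma sgn_ne_neg_one_iff (t : ℝ) : sgn t ≠ -1 ↔ 0 ≤ t := by
  unfold sgn
  split_ifs with h
  · norm_num
    exact h
  · simpa using h

lemma sgn_mul_of_pos {c : ℝ} (hc : 0 < c) (t : ℝ) : sgn (c * t) = sgn t := by
  simp only [sgn, mul_nonneg_iff_of_pos_left hc]

lemma inner_normalize {d : ℕ} {w : EuclideanSpace ℝ (Fin d)} (hw : w ≠ 0)
    (x : EuclideanSpace ℝ (Fin d)) : ⟪x, w⟫ = ‖w‖ * ⟪x, ‖w‖⁻¹ • w⟫ := by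
  rw [inner_smul_right, mul_inv_cancel_left₀ (norm_ne_zero_iff.2 hw)]

/-- A nonconstant linear classifier has a normal vector of norm one. -/
lemma sgn_inner_sub_normalize {d : ℕ} {w : EuclideanSpace ℝ (Fin d)} (hw : w ≠ 0) (b : ℝ) :
    (fun x => sgn (⟪x, w⟫ - b)) = fun x => sgn (⟪x, ‖w‖⁻¹ • w⟫ - b / ‖w‖) := by
  funext x
  have hpos := norm_pos_iff.2 hw
  rw [← sgn_mul_of_pos hpos (⟪x, ‖w‖⁻¹ • w⟫ - b / ‖w‖), mul_sub, ← inner_normalize hw, mul_div_cancel₀ _ hpos.ne']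

lemma measurableSet_inner_lt {d : ℕ} (u : EuclideanSpace ℝ (Fin d)) (t : ℝ) :
    MeasurableSet {x : EuclideanSpace ℝ (Fin d) | ⟪x, u⟫ < t} :=
  measurableSet_lt (by fun_prop) measurable_const

lemma standardRisk_linear {d : ℕ} (μ : EuclideanSpace ℝ (Fin d)) {p : ℝ} (hp0 : 0 < p)
    (hp1 : p < 1) {u : EuclideanSpace ℝ (Fin d)} (hu : ‖u‖ = 1) (b : ℝ) :
    standardRisk (gaussianMixture μ p) (fun x => sgn (⟪x, u⟫ - b)) = thresholdRisk p ⟪μ, u⟫ b := by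
  rw [standardRisk, integral_indicator_gaussianMixture μ hp0 hp1 (A := {x | ⟪x, u⟫ < b})
    (B := {x | ⟪x, -u⟫ ≤ -b}) (measurableSet_inner_lt u b)
    (measurableSet_le (by fun_prop) measurable_const),
    multivariateGaussian_real_inner_lt μ hu,
    multivariateGaussian_real_inner_le (-μ) (by rwa [norm_neg]), inner_neg_neg, thresholdRisk]
  · intro x
    simp only [Set.mem_ofPred_eq, sgn_ne_one_iff, sub_neg]
  · intro x
    simp only [Set.mem_ofPred_eq, sgn_ne_neg_one_iff, sub_nonneg, inner_neg_right, neg_le_neg_iff]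

/-- The perturbations that cause an error form a half-space at signed distance equal to the margin,
so the error slices are margin below `v`. The class `-1` is written through `-u` to become a lower
tail too. The convention for `sgn 0` is harmless because hyperplanes are null. -/
lemma robustRisk_linear {d : ℕ} {ε ρ v : ℝ} (hε : 0 < ε) (hv : IsCapDistance d ε ρ v)
    (μ : EuclideanSpace ℝ (Fin d)) {p : ℝ} (hp0 : 0 < p)
    (hp1 : p < 1) {u : EuclideanSpace ℝ (Fin d)} (hu : ‖u‖ = 1) (b : ℝ) :
    robustRisk (gaussianMixture μ p) (pertLaw d ε) ρ (fun x => sgn (⟪x, u⟫ - b)) =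
      thresholdRisk p (⟪μ, u⟫ - v) b := by
  have hu' : ‖-u‖ = 1 := by rwa [norm_neg]
  rw [robustRisk, integral_indicator_gaussianMixture μ hp0 hp1 (A := {x | ⟪x, u⟫ < b + v})
    (B := {x | ⟪x, -u⟫ < -b + v}) (measurableSet_inner_lt _ _) (measurableSet_inner_lt _ _),
    multivariateGaussian_real_inner_lt μ hu,
    multivariateGaussian_real_inner_lt (-μ) hu', inner_neg_neg, thresholdRisk]
  · ring_nf
  · intro x
    have hset : {δ | sgn (⟪x + δ, u⟫ - b) ≠ 1} = {δ | ⟪x, u⟫ - b < ⟪-u, δ⟫} := by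
      ext δ
      simp only [Set.mem_ofPred_eq, sgn_ne_one_iff, inner_add_left, inner_neg_left,
        real_inner_comm u δ]
      constructor <;> intro h <;> linarith
    simp only [Set.mem_ofPred_eq, gt_iff_lt]
    rw [hset, pertLaw_real_lt_inner ε hu', hv.lt_tailMass_iff hε hu', sub_lt_iff_lt_add']
  · intro x
    have hset : {δ | sgn (⟪x + δ, u⟫ - b) ≠ -1} = {δ | b - ⟪x, u⟫ ≤ ⟪u, δ⟫} := by
      ext δ
      simp only [Set.mem_ofPred_eq, sgn_ne_neg_one_iff, inner_add_left, real_inner_comm u δ]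
      constructor <;> intro h <;> linarith
    simp only [Set.mem_ofPred_eq, gt_iff_lt]
    rw [hset]
    change ρ < tailMass ε u _ ↔ _
    rw [hv.lt_tailMass_iff hε hu, inner_neg_right]
    constructor <;> intro h <;> linarith

lemma robustRisk_const {d : ℕ} {ε ρ : ℝ} (hε : 0 < ε) (hρ0 : 0 ≤ ρ) (hρ1 : ρ < 1)
    (μ : EuclideanSpace ℝ (Fin d)) {p : ℝ} (hp0 : 0 < p) (hp1 : p < 1) (t : ℝ) :
    robustRisk (gaussianMixture μ p) (pertLaw d ε) ρ (fun _ => sgn t) =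
      if 0 ≤ t then 1 - p else p := by
  have := isProbabilityMeasure_pertLaw d hε
  split_ifs with ht
  · have hs : sgn t = 1 := if_pos ht
    rw [robustRisk, integral_indicator_gaussianMixture μ hp0 hp1 (A := ∅) (B := Set.univ)
      MeasurableSet.empty MeasurableSet.univ]
    · simp
    · intro x
      simp [hs, hρ0]
    · intro x
      norm_num [hs, hρ1]
  · have hs : sgn t = -1 := if_neg ht
    rw [robustRisk, integral_indicator_gaussianMixture μ hp0 hp1 (A := Set.univ) (B := ∅)
      MeasurableSet.univ MeasurableSet.empty]
    · simp
    · intro x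
      norm_num [hs, hρ1]
    · intro x
      simp [hs, hρ0]

/-! ### Optimality and excess risk -/

lemma robustClassifier_eq {d : ℕ} {μ : EuclideanSpace ℝ (Fin d)} {v : ℝ} (h0 : 0 ≤ v)
    (hv : v < ‖μ‖) (p : ℝ) :
    robustClassifier μ p v =
      fun x => sgn (⟪x, ‖μ‖⁻¹ • μ⟫ - logOdds p / (2 * (‖μ‖ - v))) := by
  have hμ : 0 < ‖μ‖ := h0.trans_lt hv
  have ha : 0 < ‖μ‖ - v := sub_pos.2 hv
  funext x
  rw [robustClassifier, max_eq_right (by rw [sub_nonneg, div_le_one hμ]; exact hv.le),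
    ← sgn_mul_of_pos ha (⟪x, ‖μ‖⁻¹ • μ⟫ - logOdds p / (2 * (‖μ‖ - v)))]
  congr 1
  rw [inner_smul_right]
  field_simp

lemma bayesClassifier_eq {d : ℕ} {μ : EuclideanSpace ℝ (Fin d)} (hμ : 0 < ‖μ‖) (p : ℝ) :
    bayesClassifier μ p = fun x => sgn (⟪x, ‖μ‖⁻¹ • μ⟫ - logOdds p / (2 * ‖μ‖)) := by
  have h := sgn_inner_sub_normalize (norm_pos_iff.1 hμ) (logOdds p / 2)
  rw [div_div] at h
  exact h

lemma robustClassifier_mem {d : ℕ} (μ : EuclideanSpace ℝ (Fin d)) (p v : ℝ) :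
    robustClassifier μ p v ∈ linearClassifiers d := by
  refine ⟨max 0 (1 - v / ‖μ‖) • μ, logOdds p / 2, ?_⟩
  funext x
  rw [robustClassifier, inner_smul_right, mul_comm]

lemma norm_normalize {d : ℕ} {w : EuclideanSpace ℝ (Fin d)} (hw : w ≠ 0) :
    ‖‖w‖⁻¹ • w‖ = 1 := by
  rw [norm_smul, norm_inv, norm_norm, inv_mul_cancel₀ (norm_ne_zero_iff.2 hw)]

lemma inner_self_normalize {d : ℕ} {μ : EuclideanSpace ℝ (Fin d)} (hμ : μ ≠ 0) :
    ⟪μ, ‖μ‖⁻¹ • μ⟫ = ‖μ‖ := by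
  rw [inner_smul_right, real_inner_self_eq_norm_sq, sq,
    inv_mul_cancel_left₀ (norm_ne_zero_iff.2 hμ)]

lemma robustRisk_robustClassifier {d : ℕ} {ε ρ v : ℝ} (hε : 0 < ε) (hv : IsCapDistance d ε ρ v)
    {μ : EuclideanSpace ℝ (Fin d)} (hμ : ε < ‖μ‖) {p : ℝ} (hp0 : 0 < p) (hp1 : p < 1) :
    robustRisk (gaussianMixture μ p) (pertLaw d ε) ρ (robustClassifier μ p v) =
      thresholdRisk p (‖μ‖ - v) (logOdds p / (2 * (‖μ‖ - v))) := by
  have hne : μ ≠ 0 := norm_pos_iff.1 (hε.trans hμ)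
  obtain ⟨h0, h1, -⟩ := hv.spec
  rw [robustClassifier_eq h0 (h1.trans_lt hμ), robustRisk_linear hε hv μ hp0 hp1
    (norm_normalize hne), inner_self_normalize hne]

lemma standardRisk_bayesClassifier {d : ℕ} {μ : EuclideanSpace ℝ (Fin d)} (hμ : 0 < ‖μ‖) {p : ℝ}
    (hp0 : 0 < p) (hp1 : p < 1) :
    standardRisk (gaussianMixture μ p) (bayesClassifier μ p) =
      thresholdRisk p ‖μ‖ (logOdds p / (2 * ‖μ‖)) := by
  have hne : μ ≠ 0 := norm_pos_iff.1 hμ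
  rw [bayesClassifier_eq hμ, standardRisk_linear μ hp0 hp1 (norm_normalize hne),
    inner_self_normalize hne]

/-- A linear classifier other than the robust one has strictly larger robust risk. -/
lemma robustRisk_robustClassifier_lt {d : ℕ} {ε ρ v : ℝ} (hε : 0 < ε) (hρ0 : 0 ≤ ρ) (hρ1 : ρ < 1)
    (hv : IsCapDistance d ε ρ v) {μ : EuclideanSpace ℝ (Fin d)} (hμ : ε < ‖μ‖) {p : ℝ}
    (hp0 : 0 < p) (hp1 : p < 1) {h : EuclideanSpace ℝ (Fin d) → ℝ} (hh : h ∈ linearClassifiers d)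
    (hne : h ≠ robustClassifier μ p v) :
    robustRisk (gaussianMixture μ p) (pertLaw d ε) ρ (robustClassifier μ p v) <
      robustRisk (gaussianMixture μ p) (pertLaw d ε) ρ h := by
  obtain ⟨h0, h1, -⟩ := hv.spec
  have hμ0 : μ ≠ 0 := norm_pos_iff.1 (hε.trans hμ)
  have ha : 0 < ‖μ‖ - v := sub_pos.2 (h1.trans_lt hμ)
  rw [robustRisk_robustClassifier hε hv hμ hp0 hp1]
  obtain ⟨w, b, rfl⟩ := hh
  by_cases hw : w = 0
  · subst hw
    simp only [inner_zero_right]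
    rw [robustRisk_const hε hρ0 hρ1 μ hp0 hp1]
    split_ifs
    · exact thresholdRisk_min_lt_one_sub hp0 hp1 ha
    · exact thresholdRisk_min_lt hp0 hp1 ha
  · rw [sgn_inner_sub_normalize hw, robustClassifier_eq h0 (h1.trans_lt hμ)] at hne
    rw [sgn_inner_sub_normalize hw]
    set u := ‖w‖⁻¹ • w
    have hu : ‖u‖ = 1 := norm_normalize hw
    rw [robustRisk_linear hε hv μ hp0 hp1 hu]
    -- This is the equality case of Cauchy-Schwarz: in it the two classifiers share their direction
    -- and can differ only in the threshold.
    by_cases hum : ‖μ‖ • u = μ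
    · have hu2 : u = ‖μ‖⁻¹ • μ := by
        rw [← hum, norm_smul, hu, norm_norm, mul_one,
          inv_smul_smul₀ (norm_ne_zero_iff.2 hμ0)]
      rw [hu2] at hne ⊢
      rw [inner_self_normalize hμ0]
      refine thresholdRisk_lt_of_ne hp0 hp1 ha fun hb => hne ?_
      rw [hb]
    · have hlt : ⟪μ, u⟫ < ‖μ‖ := by
        have := (inner_lt_norm_mul_iff_real (x := μ) (y := u)).2
          (by rw [hu, one_smul]; exact Ne.symm hum)
        rwa [hu, mul_one] at this
      -- Means are compared at the threshold of `h`, so `⟪μ, u⟫ - v` is free to be nonpositive.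
      exact (thresholdRisk_min_le hp0 hp1 ha _).trans_lt
        (thresholdRisk_lt_of_lt hp0 hp1 (sub_lt_sub_right hlt v) _)

/-- The excess of the optimal robust risk over the Bayes risk is at most the cap distance. -/
lemma abs_excessRisk_le {d : ℕ} {ε ρ v : ℝ} (hε : 0 < ε) (hv : IsCapDistance d ε ρ v)
    {μ : EuclideanSpace ℝ (Fin d)} (hμ : ε < ‖μ‖) {p : ℝ} (hp0 : 0 < p) (hp1 : p < 1) :
    |robustRisk (gaussianMixture μ p) (pertLaw d ε) ρ (robustClassifier μ p v) -
      standardRisk (gaussianMixture μ p) (bayesClassifier μ p)| ≤ v := by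
  obtain ⟨h0, h1, -⟩ := hv.spec
  have hμ0 : 0 < ‖μ‖ := hε.trans hμ
  have ha : 0 < ‖μ‖ - v := sub_pos.2 (h1.trans_lt hμ)
  rw [robustRisk_robustClassifier hε hv hμ hp0 hp1, standardRisk_bayesClassifier hμ0 hp0 hp1,
    abs_of_nonneg]
  · have hb := thresholdRisk_min_le hp0 hp1 ha (logOdds p / (2 * ‖μ‖))
    have hl := thresholdRisk_sub_le hp0 hp1 (sub_le_self ‖μ‖ h0) (logOdds p / (2 * ‖μ‖))
    linarith
  · rw [sub_nonneg]
    refine (thresholdRisk_min_le hp0 hp1 hμ0 (logOdds p / (2 * (‖μ‖ - v)))).trans ?_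
    rcases h0.eq_or_lt with rfl | hpos
    · rw [sub_zero]
    · exact (thresholdRisk_lt_of_lt hp0 hp1 (sub_lt_self _ hpos) _).le

lemma IsCapDistance.le_div_sqrt {d : ℕ} {ε ρ v : ℝ} (hε : 0 < ε) (hρ : 0 < ρ) (hd : 0 < d)
    (hv : IsCapDistance d ε ρ v) : v ≤ ε / √ρ * (1 / √(d : ℝ)) := by
  have hd' : (0 : ℝ) < d := Nat.cast_pos.2 hd
  have h := hv.mul_sq_le hε
  rw [div_mul_div_comm, mul_one, ← Real.sqrt_mul hρ.le, le_div_iff₀ (by positivity)]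
  refine le_of_sq_le_sq ?_ hε.le
  rw [mul_pow, Real.sq_sqrt (by positivity)]
  linarith

end ProbRobust

theorem proposition1 (ε : ℝ) (hε : 0 < ε) (ρ : ℝ) (hρ0 : 0 ≤ ρ) (hρ1 : ρ ≤ 1 / 2) :
    -- the cap distance is well defined, and the classifier built from it is the optimal linear one
    (∀ (d : ℕ) (μ : EuclideanSpace ℝ (Fin d)) (p : ℝ), ε < ‖μ‖ → 0 < p → p < 1 →
      (∃! v : ℝ, ProbRobust.IsCapDistance d ε ρ v) ∧
      ∀ v : ℝ, ProbRobust.IsCapDistance d ε ρ v →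
        ProbRobust.robustClassifier μ p v ∈ ProbRobust.linearClassifiers d ∧
        ∀ h ∈ ProbRobust.linearClassifiers d,
          ProbRobust.robustRisk (ProbRobust.gaussianMixture μ p) (ProbRobust.pertLaw d ε) ρ
              (ProbRobust.robustClassifier μ p v) ≤
            ProbRobust.robustRisk (ProbRobust.gaussianMixture μ p) (ProbRobust.pertLaw d ε) ρ h ∧
          (ProbRobust.robustRisk (ProbRobust.gaussianMixture μ p) (ProbRobust.pertLaw d ε) ρ h =
              ProbRobust.robustRisk (ProbRobust.gaussianMixture μ p) (ProbRobust.pertLaw d ε) ρ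
                (ProbRobust.robustClassifier μ p v) →
            h = ProbRobust.robustClassifier μ p v)) ∧
    -- excess risk of order `1 / √d` when `ρ` is positive
    (0 < ρ → ∃ C : ℝ, ∀ (d : ℕ) (μ : EuclideanSpace ℝ (Fin d)) (p v : ℝ),
      ε < ‖μ‖ → 0 < p → p < 1 → ProbRobust.IsCapDistance d ε ρ v →
        |ProbRobust.robustRisk (ProbRobust.gaussianMixture μ p) (ProbRobust.pertLaw d ε) ρ
            (ProbRobust.robustClassifier μ p v) -
          ProbRobust.standardRisk (ProbRobust.gaussianMixture μ p)
            (ProbRobust.bayesClassifier μ p)| ≤ C * (1 / √(d : ℝ))) ∧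
    -- excess risk of order `1` when `ρ` is zero
    (ρ = 0 → ∃ C : ℝ, ∀ (d : ℕ) (μ : EuclideanSpace ℝ (Fin d)) (p v : ℝ),
      ε < ‖μ‖ → 0 < p → p < 1 → ProbRobust.IsCapDistance d ε ρ v →
        |ProbRobust.robustRisk (ProbRobust.gaussianMixture μ p) (ProbRobust.pertLaw d ε) ρ
            (ProbRobust.robustClassifier μ p v) -
          ProbRobust.standardRisk (ProbRobust.gaussianMixture μ p)
            (ProbRobust.bayesClassifier μ p)| ≤ C) := by
  refine ⟨fun d μ p hμ hp0 hp1 => ⟨?_, fun v hv => ⟨ProbRobust.robustClassifier_mem μ p v,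
    fun h hh => ?_⟩⟩, fun hρ => ⟨ε / √ρ, fun d μ p v hμ hp0 hp1 hv => ?_⟩,
    fun _ => ⟨ε, fun d μ p v hμ hp0 hp1 hv => ?_⟩⟩
  · exact ProbRobust.existsUnique_isCapDistance hε hρ0 hρ1
      (ProbRobust.norm_normalize (norm_pos_iff.1 (hε.trans hμ)))
  · have hlt := fun hne => ProbRobust.robustRisk_robustClassifier_lt hε hρ0 (by linarith) hv hμ
      hp0 hp1 hh hne
    refine ⟨?_, fun heq => by_contra fun hne => (hlt hne).ne' heq⟩
    by_cases hne : h = ProbRobust.robustClassifier μ p v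
    · rw [hne]
    · exact (hlt hne).le
  · refine (ProbRobust.abs_excessRisk_le hε hv hμ hp0 hp1).trans (hv.le_div_sqrt hε hρ ?_)
    -- In dimension `0` the bound would read `C * (1 / 0) = 0`, but there `μ = 0` contradicts `ε <
    -- ‖μ‖`.
    rcases Nat.eq_zero_or_pos d with rfl | hd
    · rw [Subsingleton.elim μ 0, norm_zero] at hμ
      exact absurd hμ hε.not_gt
    · exact hd
  · exact (ProbRobust.abs_excessRisk_le hε hv hμ hp0 hp1).trans hv.spec.2.1
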